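/- Let $a=(a_\ell)_{\ell\in\mathbb Z}$ be a finitely supported complex sequence with $\sum_{\ell\in\mathbb Z} a_\ell=1$, and let $\widehat F_a(\theta):=\sum_{\ell\in\mathbb Z}a_\ell\,e^{i\ell\theta}$, $\theta\in\mathbb C$, be its Fourier transform. Assume that $|\widehat F_a(\theta)|<1$ for every $\theta\in[-\pi,\pi]\setminus\{0\}$, and that there exist $\alpha\in\mathbb R$, $c_3\in\mathbb R\setminus\{0\}$, $c_4>0$ and a function $\varphi$ holomorphic on a neighborhood of $0$ in $\mathbb C$ such that, for all complex $\theta$ in a neighborhood of $0$, $$\widehat F_a(\theta)=\exp\bigl(i\alpha\theta-i c_3\theta^3-c_4\theta^4+\theta^5\varphi(\theta)\bigr).$$ Let $L_a$ be the Laurent (convolution) operator $(L_a u)_j:=\sum_{\ell\in\mathbb Z}a_\ell\,u_{j-\ell}$, $j\in\mathbb Z$, acting on complex sequences indexed by $\mathbb Z$. Then there exists a constant $C>0$, depending only on $a$, such that for every complex sequence $u=(u_j)_{j\in\mathbb Z}$ of bounded variation (that is, $\sum_{j\in\mathbb Z}|u_{j+1}-u_j|<\infty$) with $\lim_{j\to-\infty}u_j=0$,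 $$\sup_{n\in\mathbb N}\ \sup_{j\in\mathbb Z}\ \bigl|(L_a^{\,n}u)_j\bigr|\ \le\ C\sum_{j\in\mathbb Z}|u_{j+1}-u_j|.$$ -/

import Mathlib

open scoped ENNReal NNReal Topology

noncomputable section

namespace LaurentBV

/-- The Laurent (convolution) operator `L_a u = a ⋆ u`, `(L_a u)_j = ∑_ℓ a_ℓ u_{j-ℓ}`.
It is only used below for finitely supported `a`, for which every series is a finite sum. -/
def laurentOp (a : ℤ → ℂ) (u : ℤ → ℂ) : ℤ → ℂ :=
  fun j => ∑' ℓ : ℤ, a ℓ * u (j - ℓ)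

/-- The Fourier transform `F_a(θ) = ∑_ℓ a_ℓ e^{iℓθ}` of a finitely supported sequence, at a
complex argument `θ` (for finitely supported `a` it is an entire function). -/
def fourierSymbol (a : ℤ → ℂ) (θ : ℂ) : ℂ :=
  ∑' ℓ : ℤ, a ℓ * Complex.exp (Complex.I * (ℓ : ℂ) * θ)

/-- The standing assumption on the sequence `a`: finite support, total mass one, dissipation away
from the frequency `0`, and a dispersive expansion at the frequency `0`. -/
structure DispersiveAssumption (a : ℤ → ℂ) : Prop where
  finite_support : (Function.support a).Finite
  sum_eq_one : ∑' ℓ : ℤ, a ℓ = 1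
  dissipation : ∀ θ : ℝ, θ ∈ Set.Icc (-Real.pi) Real.pi \ {0} → ‖fourierSymbol a (θ : ℂ)‖ < 1
  expansion : ∃ α c₃ c₄ : ℝ, c₃ ≠ 0 ∧ 0 < c₄ ∧ ∃ φ : ℂ → ℂ, AnalyticAt ℂ φ 0 ∧
    ∀ᶠ θ : ℂ in 𝓝 0, fourierSymbol a θ =
      Complex.exp (Complex.I * (α : ℂ) * θ - Complex.I * (c₃ : ℂ) * θ ^ 3
        - (c₄ : ℂ) * θ ^ 4 + θ ^ 5 * φ θ)

/-- The total variation `∑_j |u_{j+1} - u_j| ∈ [0, ∞]` of a sequence. -/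
def totalVariation (u : ℤ → ℂ) : ℝ≥0∞ :=
  ∑' j : ℤ, ‖u (j + 1) - u j‖ₑ

/-- `u ∈ BV(ℤ; ℂ)`: the total variation is finite. -/
def BV (u : ℤ → ℂ) : Prop :=
  totalVariation u < ∞

/-- The `ℓ^∞` norm `sup_j |v_j| ∈ [0, ∞]` (equal to `∞` exactly for unbounded sequences). -/
def supNorm (v : ℤ → ℂ) : ℝ≥0∞ :=
  ⨆ j : ℤ, ‖v j‖ₑ

end LaurentBV

end

/-
A sequence of bounded variation vanishing at `-∞` is a superposition of translated unit steps
weighted by its jumps, so it suffices to bound `L_a^n` on one unit step, uniformly in `n`. The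
Dirichlet kernel writes the values there as integrals over `(0, π)` of the odd part of
`e^{ixθ} F(-θ)^n` divided by `sin (θ / 2)`, where `F` is the Fourier transform of `a`; the
difficulty is the nonintegrable singularity `1 / θ`. Cut the frequencies at `A ≈ n^{-1/4}`. For
`θ ≤ A`, replacing `F^n` by the purely dispersive `e^{in(αθ - c₃θ³)}` costs only `O(nθ⁴)`, and the
remaining integrals of `sin (xθ + yθ³) / θ` are bounded uniformly in `x` and `y` by van der
Corput's lemma. Beyond `A`, up to a fixed small frequency, the damping `e^{-cnθ⁴} ≤ 1 / (cnθ⁴)`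
compensates `1 / θ`, and for the remaining frequencies `|F| ≤ 1` suffices.
-/

section OscillatoryIntegrals

open Set Complex MeasureTheory intervalIntegral

theorem norm_integral_smul_deriv_le_of_deriv_nonpos {E : Type*} [NormedAddCommGroup E]
    [NormedSpace ℝ E] [CompleteSpace E] {ψ ψ' : ℝ → ℝ} {v v' : ℝ → E} {a b M : ℝ} (hab : a ≤ b)
    (hψ : ∀ t ∈ Icc a b, HasDerivAt ψ (ψ' t) t) (hψ' : ∀ t ∈ Icc a b, ψ' t ≤ 0)
    (hv : ∀ t ∈ Icc a b, HasDerivAt v (v' t) t) (hv' : IntervalIntegrable v' volume a b)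
    (hM : ∀ t ∈ Icc a b, ‖v t‖ ≤ M) :
    ‖∫ t in a..b, ψ t • v' t‖ ≤ (|ψ a| + |ψ b| + (ψ a - ψ b)) * M := by
  have hψ'_int : IntervalIntegrable (fun t => -ψ' t) volume a b :=
    (intervalIntegrable_iff_integrableOn_Ioc_of_le hab).2 <|
      integrableOn_deriv_of_nonneg (HasDerivAt.continuousOn hψ).neg
        (fun t ht => (hψ t (Ioo_subset_Icc_self ht)).neg)
        (fun t ht => neg_nonneg.2 (hψ' t (Ioo_subset_Icc_self ht)))
  rw [← uIcc_of_le hab] at hψ hv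
  have hrest : ‖∫ t in a..b, ψ' t • v t‖ ≤ (ψ a - ψ b) * M := by
    calc ‖∫ t in a..b, ψ' t • v t‖ ≤ ∫ t in a..b, -ψ' t * M := by
          refine norm_integral_le_of_norm_le hab (.of_forall fun t ht => ?_) (hψ'_int.mul_const M)
          have ht' := Ioc_subset_Icc_self ht
          rw [norm_smul, Real.norm_eq_abs, abs_of_nonpos (hψ' t ht')]
          exact mul_le_mul_of_nonneg_left (hM t ht') (neg_nonneg.2 (hψ' t ht'))
      _ = (ψ a - ψ b) * M := by
          rw [intervalIntegral.integral_mul_const,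
            integral_eq_sub_of_hasDerivAt (fun t ht => (hψ t ht).fun_neg) hψ'_int]
          ring
  rw [integral_smul_deriv_eq_deriv_smul hψ hv (by simpa using hψ'_int.const_mul (-1)) hv']
  calc ‖ψ b • v b - ψ a • v a - ∫ t in a..b, ψ' t • v t‖
      ≤ ‖ψ b • v b‖ + ‖ψ a • v a‖ + ‖∫ t in a..b, ψ' t • v t‖ :=
        (norm_sub_le _ _).trans (add_le_add_left (norm_sub_le _ _) _)
    _ ≤ |ψ b| * M + |ψ a| * M + (ψ a - ψ b) * M := by
        rw [norm_smul, norm_smul, Real.norm_eq_abs, Real.norm_eq_abs]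
        gcongr
        · exact hM b (right_mem_Icc.2 hab)
        · exact hM a (left_mem_Icc.2 hab)
    _ = _ := by ring

theorem norm_integral_le_of_norm_integral_away_le {E : Type*} [NormedAddCommGroup E]
    [NormedSpace ℝ E] {f : ℝ → E} {a b c D ε : ℝ} (hc : c ∈ Icc a b) (hD : 0 ≤ D) (hε : 0 ≤ ε)
    (hf : IntervalIntegrable f volume a b) (hf1 : ∀ t ∈ Icc a b, ‖f t‖ ≤ 1)
    (haway : ∀ s t, a ≤ s → s ≤ t → t ≤ b → (∀ r ∈ Icc s t, ε ≤ |r - c|) →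
      ‖∫ r in s..t, f r‖ ≤ D) :
    ‖∫ t in a..b, f t‖ ≤ 2 * D + 2 * ε := by
  set m := max a (c - ε) with hm
  set k := min b (c + ε) with hk
  have hmc : m ≤ c := max_le hc.1 (by linarith)
  have hck : c ≤ k := le_min hc.2 (by linarith)
  have ham : a ≤ m := le_max_left _ _
  have hkb : k ≤ b := min_le_left _ _
  have hmk : m ≤ k := hmc.trans hck
  have hleft : ‖∫ r in a..m, f r‖ ≤ D := by
    rcases le_total (c - ε) a with h | h
    · rwa [hm, max_eq_left h, integral_same, norm_zero]
    · refine haway a m le_rfl ham (hmc.trans hc.2) fun r hr => ?_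
      rw [hm, max_eq_right h] at hr
      exact le_abs.2 (.inr (by linarith [hr.2]))
  have hright : ‖∫ r in k..b, f r‖ ≤ D := by
    rcases le_total b (c + ε) with h | h
    · rwa [hk, min_eq_left h, integral_same, norm_zero]
    · refine haway k b (hc.1.trans hck) hkb le_rfl fun r hr => ?_
      rw [hk, min_eq_right h] at hr
      exact le_abs.2 (.inl (by linarith [hr.1]))
  have hmid : ‖∫ r in m..k, f r‖ ≤ 2 * ε := by
    have := norm_integral_le_of_norm_le_const (a := m) (b := k) (C := 1) (f := f) fun r hr => by
      rw [uIoc_of_le hmk] at hr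
      exact hf1 r ⟨ham.trans hr.1.le, hr.2.trans hkb⟩
    rw [one_mul, abs_of_nonneg (sub_nonneg.2 hmk)] at this
    linarith [le_max_right a (c - ε), min_le_right b (c + ε)]
  have hint : ∀ s t, a ≤ s → s ≤ t → t ≤ b → IntervalIntegrable f volume s t :=
    fun s t has hst htb => hf.mono_set <| by
      rw [uIcc_of_le hst, uIcc_of_le (has.trans (hst.trans htb))]
      exact Icc_subset_Icc has htb
  rw [← integral_add_adjacent_intervals (hint a m le_rfl ham (hmk.trans hkb))
      (hint m b ham (hmk.trans hkb) le_rfl),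
    ← integral_add_adjacent_intervals (hint m k ham hmk hkb) (hint k b (ham.trans hmk) hkb le_rfl)]
  have h₁ := norm_add_le (∫ r in a..m, f r) ((∫ r in m..k, f r) + ∫ r in k..b, f r)
  have h₂ := norm_add_le (∫ r in m..k, f r) (∫ r in k..b, f r)
  linarith

section VanDerCorput

variable {p q q' : ℝ → ℝ} {a b L : ℝ}

/- Integrate `e^{ip} = (i q)⁻¹ (e^{ip})'` by parts; `1 / q` is monotone. -/
theorem norm_integral_exp_mul_I_le_of_le_abs_deriv (hab : a ≤ b) (hL : 0 < L)
    (hp : ∀ t ∈ Icc a b, HasDerivAt p (q t) t) (hq : ∀ t ∈ Icc a b, HasDerivAt q (q' t) t)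
    (hq' : ∀ t ∈ Icc a b, 0 ≤ q' t) (hLq : ∀ t ∈ Icc a b, L ≤ |q t|) :
    ‖∫ t in a..b, exp (p t * I)‖ ≤ 4 / L := by
  have hq0 : ∀ t ∈ Icc a b, q t ≠ 0 := fun t ht => abs_pos.1 (hL.trans_le (hLq t ht))
  have hinv : ∀ t ∈ Icc a b, |(q t)⁻¹| ≤ L⁻¹ := fun t ht => by
    rw [abs_inv]; exact inv_anti₀ hL (hLq t ht)
  have hpc : ContinuousOn p (Icc a b) := HasDerivAt.continuousOn hp
  have hqc : ContinuousOn q (Icc a b) := HasDerivAt.continuousOn hq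
  have hparts := norm_integral_smul_deriv_le_of_deriv_nonpos (ψ := fun t => (q t)⁻¹)
    (v := fun t => exp (p t * I)) (M := 1) hab (fun t ht => (hq t ht).fun_inv (hq0 t ht))
    (fun t ht => div_nonpos_of_nonpos_of_nonneg (neg_nonpos.2 (hq' t ht)) (sq_nonneg _))
    (fun t ht => ((hp t ht).ofReal_comp.mul_const I).cexp)
    (ContinuousOn.intervalIntegrable_of_Icc hab (by fun_prop))
    (fun t _ => (norm_exp_ofReal_mul_I _).le)
  have hcancel : ∫ t in a..b, (q t)⁻¹ • (exp (p t * I) * (q t * I))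
      = (∫ t in a..b, exp (p t * I)) * I := by
    rw [← intervalIntegral.integral_mul_const]
    refine integral_congr fun t ht => ?_
    rw [uIcc_of_le hab] at ht
    have : (q t : ℂ) ≠ 0 := ofReal_ne_zero.2 (hq0 t ht)
    simp only [real_smul, ofReal_inv]
    field_simp
  rw [hcancel, norm_mul, norm_I, mul_one, mul_one] at hparts
  have ha := abs_le.1 (hinv a (left_mem_Icc.2 hab))
  have hb := abs_le.1 (hinv b (right_mem_Icc.2 hab))
  calc ‖∫ t in a..b, exp (p t * I)‖
      ≤ |(q a)⁻¹| + |(q b)⁻¹| + ((q a)⁻¹ - (q b)⁻¹) := hparts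
    _ ≤ L⁻¹ + L⁻¹ + (L⁻¹ - -L⁻¹) :=
        add_le_add (add_le_add (abs_le.2 ha) (abs_le.2 hb)) (sub_le_sub ha.2 hb.1)
    _ = 4 / L := by ring

theorem exists_forall_mul_abs_sub_le_abs_of_le_deriv {μ : ℝ} (hab : a ≤ b)
    (hq : ∀ t ∈ Icc a b, HasDerivAt q (q' t) t) (hμ : ∀ t ∈ Icc a b, μ ≤ q' t) :
    ∃ c ∈ Icc a b, ∀ t ∈ Icc a b, μ * |t - c| ≤ |q t| := by
  have hqc : ContinuousOn q (Icc a b) := HasDerivAt.continuousOn hq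
  have hgrow : ∀ s ∈ Icc a b, ∀ t ∈ Icc a b, s ≤ t → μ * (t - s) ≤ q t - q s :=
    (convex_Icc a b).mul_sub_le_image_sub_of_le_deriv hqc
      (fun t ht => (hq t (interior_subset ht)).differentiableAt.differentiableWithinAt)
      (fun t ht => (hq t (interior_subset ht)).deriv ▸ hμ t (interior_subset ht))
  have ha := left_mem_Icc.2 hab
  have hb := right_mem_Icc.2 hab
  rcases le_total 0 (q a) with hqa | hqa
  · refine ⟨a, ha, fun t ht => ?_⟩
    rw [abs_of_nonneg (sub_nonneg.2 ht.1)]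
    linarith [hgrow a ha t ht ht.1, le_abs_self (q t)]
  rcases le_total (q b) 0 with hqb | hqb
  · refine ⟨b, hb, fun t ht => ?_⟩
    rw [abs_sub_comm, abs_of_nonneg (sub_nonneg.2 ht.2)]
    linarith [hgrow t ht b hb ht.2, neg_le_abs (q t)]
  obtain ⟨c, hc, hqc0⟩ := intermediate_value_Icc hab hqc ⟨hqa, hqb⟩
  refine ⟨c, hc, fun t ht => ?_⟩
  rcases le_total c t with hct | htc
  · rw [abs_of_nonneg (sub_nonneg.2 hct)]
    linarith [hgrow c hc t ht hct, le_abs_self (q t)]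
  · rw [abs_sub_comm, abs_of_nonneg (sub_nonneg.2 htc)]
    linarith [hgrow t ht c hc htc, neg_le_abs (q t)]

theorem norm_integral_exp_mul_I_le_of_sq_le_deriv2 (hab : a ≤ b) (hL : 0 < L)
    (hp : ∀ t ∈ Icc a b, HasDerivAt p (q t) t) (hq : ∀ t ∈ Icc a b, HasDerivAt q (q' t) t)
    (hq' : ∀ t ∈ Icc a b, L ^ 2 ≤ q' t) :
    ‖∫ t in a..b, exp (p t * I)‖ ≤ 8 / L := by
  obtain ⟨c, hc, hqc⟩ := exists_forall_mul_abs_sub_le_abs_of_le_deriv hab hq hq'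
  have hpc : ContinuousOn p (Icc a b) := HasDerivAt.continuousOn hp
  have hfar : ∀ s t, a ≤ s → s ≤ t → t ≤ b → (∀ r ∈ Icc s t, 2 / L ≤ |r - c|) →
      ‖∫ r in s..t, exp (p r * I)‖ ≤ 2 / L := by
    intro s t has hst htb hr
    have hsub : Icc s t ⊆ Icc a b := Icc_subset_Icc has htb
    have hlow : ∀ r ∈ Icc s t, 2 * L ≤ |q r| := fun r hrst => by
      calc 2 * L = L ^ 2 * (2 / L) := by field_simp
        _ ≤ L ^ 2 * |r - c| := by gcongr; exact hr r hrst
        _ ≤ |q r| := hqc r (hsub hrst)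
    refine (norm_integral_exp_mul_I_le_of_le_abs_deriv hst (by positivity : 0 < 2 * L)
      (fun r h => hp r (hsub h)) (fun r h => hq r (hsub h))
      (fun r h => (sq_nonneg L).trans (hq' r (hsub h))) hlow).trans_eq ?_
    field_simp
    norm_num
  calc ‖∫ t in a..b, exp (p t * I)‖ ≤ 2 * (2 / L) + 2 * (2 / L) :=
        norm_integral_le_of_norm_integral_away_le hc (by positivity) (by positivity)
          (ContinuousOn.intervalIntegrable_of_Icc hab (by fun_prop))
          (fun t _ => (norm_exp_ofReal_mul_I _).le) hfar
    _ = 8 / L := by ring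

end VanDerCorput

section SineIntegrals

theorem abs_integral_sin_le_norm_integral_exp_mul_I {p : ℝ → ℝ} {a b : ℝ} (hab : a ≤ b)
    (hp : ContinuousOn p (Icc a b)) :
    |∫ t in a..b, Real.sin (p t)| ≤ ‖∫ t in a..b, exp (p t * I)‖ := by
  have hint : IntervalIntegrable (fun t => exp (p t * I)) volume a b :=
    ContinuousOn.intervalIntegrable_of_Icc hab (by fun_prop)
  have him : ∫ t in a..b, Real.sin (p t) = (∫ t in a..b, exp (p t * I)).im := by
    have := imCLM.intervalIntegral_comp_comm hint
    simpa only [imCLM_apply, exp_ofReal_mul_I_im] using this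
  rw [him]
  exact abs_im_le_norm _

theorem abs_integral_div_self_le {f : ℝ → ℝ} {a b M : ℝ} (ha : 0 < a) (hab : a ≤ b)
    (hf : Continuous f) (hM : ∀ t ∈ Icc a b, |∫ s in a..t, f s| ≤ M) :
    |∫ t in a..b, f t / t| ≤ 2 * M / a := by
  have hparts := norm_integral_smul_deriv_le_of_deriv_nonpos (ψ := fun t => t⁻¹)
    (v := fun t => ∫ s in a..t, f s) hab
    (fun t ht => hasDerivAt_inv (ha.trans_le ht.1).ne')
    (fun t _ => neg_nonpos.2 (inv_nonneg.2 (sq_nonneg t)))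
    (fun t _ => hf.integral_hasStrictDerivAt a t |>.hasDerivAt) (hf.intervalIntegrable a b) hM
  simp only [smul_eq_mul, ← div_eq_inv_mul, Real.norm_eq_abs] at hparts
  refine hparts.trans_eq ?_
  rw [abs_of_pos (inv_pos.2 ha), abs_of_pos (inv_pos.2 (ha.trans_le hab))]
  ring

theorem intervalIntegrable_sin_mul_div_self {r : ℝ → ℝ} (hr : Continuous r) (a b : ℝ) :
    IntervalIntegrable (fun t => Real.sin (t * r t) / t) volume a b := by
  have hsinc : IntervalIntegrable (fun t => r t * Real.sinc (t * r t)) volume a b :=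
    (hr.mul (Real.continuous_sinc.comp (continuous_id.mul hr))).intervalIntegrable a b
  refine hsinc.congr_ae (ae_restrict_of_ae ?_)
  filter_upwards [Measure.ae_ne volume (0 : ℝ)] with t ht
  rcases eq_or_ne (r t) 0 with h0 | h0
  · simp [h0]
  · rw [Real.sinc_of_ne_zero (mul_ne_zero ht h0)]
    field_simp

theorem abs_integral_sin_mul_div_self_le (x : ℝ) {X : ℝ} (hX : 0 ≤ X) :
    |∫ t in (0 : ℝ)..X, Real.sin (x * t) / t| ≤ 9 := by
  wlog hx : 0 < x generalizing x
  · rcases (not_lt.1 hx).eq_or_lt with rfl | hx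
    · simp
    · simpa only [neg_mul, Real.sin_neg, neg_div, intervalIntegral.integral_neg, abs_neg] using
        this (-x) (neg_pos.2 hx)
  have hint := intervalIntegrable_sin_mul_div_self (r := fun _ => x) continuous_const
  simp only [mul_comm _ x] at hint
  have hsmall : ∀ Y, 0 ≤ Y → |∫ t in (0 : ℝ)..Y, Real.sin (x * t) / t| ≤ x * Y := fun Y hY => by
    have := norm_integral_le_of_norm_le_const (a := 0) (b := Y) (C := x)
      (f := fun t => Real.sin (x * t) / t) fun t ht => by
        rw [uIoc_of_le hY] at ht
        rw [norm_div, Real.norm_eq_abs, Real.norm_of_nonneg ht.1.le, div_le_iff₀ ht.1]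
        exact Real.abs_sin_le_abs.trans_eq (abs_of_pos (mul_pos hx ht.1))
    rwa [sub_zero, abs_of_nonneg hY] at this
  rcases le_total X x⁻¹ with hXx | hxX
  · calc _ ≤ x * X := hsmall X hX
      _ ≤ x * x⁻¹ := by gcongr
      _ ≤ 9 := by rw [mul_inv_cancel₀ hx.ne']; norm_num
  have hlarge : |∫ t in x⁻¹..X, Real.sin (x * t) / t| ≤ 2 * (4 / x) / x⁻¹ :=
    abs_integral_div_self_le (inv_pos.2 hx) hxX (by fun_prop) fun t ht =>
      (abs_integral_sin_le_norm_integral_exp_mul_I ht.1 (by fun_prop)).trans <|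
        norm_integral_exp_mul_I_le_of_le_abs_deriv (q := fun _ => x) (q' := fun _ => 0) ht.1 hx
          (fun s _ => by simpa using (hasDerivAt_id' s).const_mul x)
          (fun s _ => hasDerivAt_const s x) (fun _ _ => le_rfl) (fun _ _ => le_abs_self x)
  rw [← integral_add_adjacent_intervals (hint 0 x⁻¹) (hint x⁻¹ X)]
  calc _ ≤ x * x⁻¹ + 2 * (4 / x) / x⁻¹ :=
        (abs_add_le _ _).trans (add_le_add (hsmall _ (inv_pos.2 hx).le) hlarge)
    _ = 9 := by field_simp; norm_num

theorem intervalIntegrable_sin_linear_add_cubic_div_self (x y a b : ℝ) :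
    IntervalIntegrable (fun t => Real.sin (x * t + y * t ^ 3) / t) volume a b := by
  have hfactor : ∀ t : ℝ, x * t + y * t ^ 3 = t * (x + y * t ^ 2) := fun t => by ring
  simp only [hfactor]
  exact intervalIntegrable_sin_mul_div_self (by fun_prop) a b

theorem abs_integral_sin_linear_add_cubic_div_self_le_of_mul_pow_le_one (x : ℝ) {y T : ℝ}
    (hy : 0 ≤ y) (hT : 0 ≤ T) (hyT : y * T ^ 3 ≤ 1) :
    |∫ t in (0 : ℝ)..T, Real.sin (x * t + y * t ^ 3) / t| ≤ 10 := by
  have hint := intervalIntegrable_sin_linear_add_cubic_div_self x y 0 T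
  have hlin : IntervalIntegrable (fun t => Real.sin (x * t) / t) volume 0 T := by
    simpa only [zero_mul, add_zero] using intervalIntegrable_sin_linear_add_cubic_div_self x 0 0 T
  have hpert : |∫ t in (0 : ℝ)..T, (Real.sin (x * t + y * t ^ 3) / t - Real.sin (x * t) / t)|
      ≤ 1 := by
    have := norm_integral_le_of_norm_le_const (a := 0) (b := T) (C := y * T ^ 2)
      (f := fun t => Real.sin (x * t + y * t ^ 3) / t - Real.sin (x * t) / t) fun t ht => by
        rw [uIoc_of_le hT] at ht
        have hsin := Real.abs_sin_sub_sin_le (x * t + y * t ^ 3) (x * t)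
        have hpos : 0 ≤ y * t ^ 3 := mul_nonneg hy (pow_nonneg ht.1.le 3)
        rw [add_sub_cancel_left, abs_of_nonneg hpos] at hsin
        rw [← sub_div, norm_div, Real.norm_eq_abs, Real.norm_of_nonneg ht.1.le, div_le_iff₀ ht.1]
        calc _ ≤ y * t ^ 2 * t := hsin.trans_eq (by ring)
          _ ≤ y * T ^ 2 * t := by have := ht.1; gcongr; exact ht.2
    rw [sub_zero, abs_of_nonneg hT] at this
    exact this.trans (le_of_eq_of_le (by ring) hyT)
  rw [integral_sub hint hlin] at hpert
  linarith [abs_integral_sin_mul_div_self_le x hT, abs_sub_abs_le_abs_sub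
    (∫ t in (0 : ℝ)..T, Real.sin (x * t + y * t ^ 3) / t) (∫ t in (0 : ℝ)..T, Real.sin (x * t) / t)]

theorem abs_integral_sin_linear_add_cubic_div_self_le_of_one_le_mul_pow (x : ℝ) {y T X : ℝ}
    (hT : 0 < T) (hyT : 1 ≤ y * T ^ 3) (hTX : T ≤ X) :
    |∫ t in T..X, Real.sin (x * t + y * t ^ 3) / t| ≤ 8 := by
  have hconvex : ∀ s, T ≤ s → (2 / T) ^ 2 ≤ 6 * y * s := fun s hs => by
    have hy : 0 ≤ y := (pos_of_mul_pos_left (one_pos.trans_le hyT) (by positivity)).le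
    calc (2 / T) ^ 2 ≤ 6 / T ^ 2 * 1 := by rw [div_pow, mul_one]; gcongr; norm_num
      _ ≤ 6 / T ^ 2 * (y * T ^ 3) := by gcongr
      _ = 6 * y * T := by field_simp
      _ ≤ 6 * y * s := by gcongr
  have hphase : ∀ s, HasDerivAt (fun t => x * t + y * t ^ 3) (x + y * (3 * s ^ 2)) s := fun s => by
    simpa using ((hasDerivAt_id' s).const_mul x).fun_add ((hasDerivAt_pow 3 s).const_mul y)
  have hphase' : ∀ s, HasDerivAt (fun t => x + y * (3 * t ^ 2)) (6 * y * s) s := fun s =>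
    ((((hasDerivAt_pow 2 s).const_mul 3).const_mul y).const_add x).congr_deriv
      (by push_cast; ring)
  calc _ ≤ 2 * (8 / (2 / T)) / T :=
        abs_integral_div_self_le hT hTX (by fun_prop) fun t ht =>
          (abs_integral_sin_le_norm_integral_exp_mul_I ht.1 (by fun_prop)).trans <|
            norm_integral_exp_mul_I_le_of_sq_le_deriv2 ht.1 (by positivity)
              (fun s _ => hphase s) (fun s _ => hphase' s) (fun s hs => hconvex s hs.1)
    _ = 8 := by field_simp

theorem abs_integral_sin_linear_add_cubic_div_self_le_of_pos (x : ℝ) {y X : ℝ} (hy : 0 < y)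
    (hX : 0 ≤ X) : |∫ t in (0 : ℝ)..X, Real.sin (x * t + y * t ^ 3) / t| ≤ 18 := by
  obtain ⟨T, hT, hyT⟩ : ∃ T : ℝ, 0 < T ∧ y * T ^ 3 = 1 := by
    refine ⟨y⁻¹ ^ ((3 : ℕ) : ℝ)⁻¹, by positivity, ?_⟩
    rw [Real.rpow_inv_natCast_pow (inv_pos.2 hy).le three_ne_zero, mul_inv_cancel₀ hy.ne']
  rcases le_total X T with hXT | hTX
  · have hyX : y * X ^ 3 ≤ 1 := le_of_le_of_eq (by gcongr) hyT
    linarith [abs_integral_sin_linear_add_cubic_div_self_le_of_mul_pow_le_one x hy.le hX hyX]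
  · have hint := intervalIntegrable_sin_linear_add_cubic_div_self x y
    rw [← integral_add_adjacent_intervals (hint 0 T) (hint T X)]
    calc _ ≤ (10 : ℝ) + 8 := (abs_add_le _ _).trans <| add_le_add
          (abs_integral_sin_linear_add_cubic_div_self_le_of_mul_pow_le_one x hy.le hT.le hyT.le)
          (abs_integral_sin_linear_add_cubic_div_self_le_of_one_le_mul_pow x hT hyT.ge hTX)
      _ = 18 := by norm_num

theorem abs_integral_sin_linear_add_cubic_div_self_le (x y : ℝ) {X : ℝ} (hX : 0 ≤ X) :
    |∫ t in (0 : ℝ)..X, Real.sin (x * t + y * t ^ 3) / t| ≤ 18 := by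
  rcases lt_trichotomy 0 y with hy | rfl | hy
  · exact abs_integral_sin_linear_add_cubic_div_self_le_of_pos x hy hX
  · simpa using (abs_integral_sin_mul_div_self_le x hX).trans (by norm_num)
  · have := abs_integral_sin_linear_add_cubic_div_self_le_of_pos (-x) (neg_pos.2 hy) hX
    simpa only [neg_mul, ← neg_add, Real.sin_neg, neg_div, intervalIntegral.integral_neg,
      abs_neg] using this

end SineIntegrals

end OscillatoryIntegrals

section SingularIntegral

open Set Complex Filter MeasureTheory intervalIntegral Asymptotics

theorem norm_pow_sub_pow_le_of_norm_le_one {R : Type*} [SeminormedRing R] [NormOneClass R]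
    {x y : R} (hx : ‖x‖ ≤ 1) (hy : ‖y‖ ≤ 1) (n : ℕ) : ‖x ^ n - y ^ n‖ ≤ n * ‖x - y‖ := by
  induction n with
  | zero => simp
  | succ n ih =>
    calc ‖x ^ (n + 1) - y ^ (n + 1)‖ = ‖x ^ n * (x - y) + (x ^ n - y ^ n) * y‖ := by
          rw [pow_succ, pow_succ]; noncomm_ring
      _ ≤ ‖x ^ n‖ * ‖x - y‖ + ‖x ^ n - y ^ n‖ * ‖y‖ :=
          (norm_add_le _ _).trans (add_le_add (norm_mul_le _ _) (norm_mul_le _ _))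
      _ ≤ 1 * ‖x - y‖ + n * ‖x - y‖ * 1 := by
          gcongr
          exact (norm_pow_le x n).trans (pow_le_one₀ (norm_nonneg x) hx)
      _ = (n + 1 : ℕ) * ‖x - y‖ := by push_cast; ring

theorem norm_integral_le_div_of_norm_le_div_sq {E : Type*} [NormedAddCommGroup E]
    [NormedSpace ℝ E] {f : ℝ → E} {a b M : ℝ} (ha : 0 < a) (hab : a ≤ b) (hM : 0 ≤ M)
    (hf : ∀ t ∈ Icc a b, ‖f t‖ ≤ M / t ^ 2) : ‖∫ t in a..b, f t‖ ≤ M / a := by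
  have hpos : ∀ t ∈ uIcc a b, 0 < t := fun t ht => by
    rw [uIcc_of_le hab] at ht; exact ha.trans_le ht.1
  have hint : IntervalIntegrable (fun t : ℝ => M / t ^ 2) volume a b :=
    ContinuousOn.intervalIntegrable <| continuousOn_const.div (by fun_prop)
      fun t ht => (pow_pos (hpos t ht) 2).ne'
  have hprim : ∀ t ∈ uIcc a b, HasDerivAt (fun t : ℝ => -(M * t⁻¹)) (M / t ^ 2) t := fun t ht =>
    ((hasDerivAt_inv (hpos t ht).ne').const_mul M).fun_neg.congr_deriv (by ring)
  calc ‖∫ t in a..b, f t‖ ≤ ∫ t in a..b, M / t ^ 2 :=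
        norm_integral_le_of_norm_le hab (.of_forall fun t ht => hf t (Ioc_subset_Icc_self ht)) hint
    _ = M / a - M / b := by rw [integral_eq_sub_of_hasDerivAt hprim hint]; ring
    _ ≤ M / a := sub_le_self _ (div_nonneg hM (ha.le.trans hab))

section SineHalf

variable {θ : ℝ}

theorem sin_half_pos (h0 : 0 < θ) (hπ : θ ≤ Real.pi) : 0 < Real.sin (θ / 2) :=
  Real.sin_pos_of_pos_of_lt_pi (half_pos h0) (by linarith)

theorem inv_sin_half_le (h0 : 0 < θ) (hπ : θ ≤ Real.pi) :
    (Real.sin (θ / 2))⁻¹ ≤ Real.pi / θ := by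
  have hsin := Real.mul_le_sin (x := θ / 2) (by linarith) (by linarith)
  rw [← inv_div θ Real.pi]
  exact inv_anti₀ (div_pos h0 Real.pi_pos) (le_of_eq_of_le (by ring) hsin)

theorem abs_inv_sin_half_sub_le (h0 : 0 < θ) (h1 : θ ≤ 1) :
    |(Real.sin (θ / 2))⁻¹ - 2 / θ| ≤ 1 := by
  have hπ : θ ≤ Real.pi := by linarith [Real.pi_gt_three]
  have hpos := sin_half_pos h0 hπ
  have hlt := Real.sin_lt (x := θ / 2) (by linarith)
  have hgt := Real.sin_gt_sub_cube (x := θ / 2) (by linarith)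
  have hdiff : (Real.sin (θ / 2))⁻¹ - 2 / θ
      = (θ / 2 - Real.sin (θ / 2)) * (2 / θ) * (Real.sin (θ / 2))⁻¹ := by
    field_simp
  rw [hdiff, abs_of_nonneg (mul_nonneg (mul_nonneg (by linarith) (by positivity)) (by positivity))]
  calc (θ / 2 - Real.sin (θ / 2)) * (2 / θ) * (Real.sin (θ / 2))⁻¹
      ≤ (θ / 2) ^ 3 / 6 * (2 / θ) * (Real.pi / θ) := by
        gcongr
        · linarith
        · exact inv_sin_half_le h0 hπ
    _ = Real.pi * θ / 24 := by field_simp; norm_num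
    _ ≤ 1 := by nlinarith [Real.pi_lt_four, Real.pi_pos]

end SineHalf

/-- The odd part in `θ` of `i e^{-ixθ} G(θ)`. When `G(θ) = ∑ b_k e^{ikθ}` it equals
`∑ b_k sin((x - k)θ)`, so that dividing by `sin(θ/2)` superposes Dirichlet kernels. -/
noncomputable def modulatedOddPart (G : ℝ → ℂ) (x θ : ℝ) : ℂ :=
  (exp ((x * θ : ℝ) * I) * G (-θ) - exp ((-(x * θ) : ℝ) * I) * G θ) / (2 * I)

section ModulatedOddPart

variable {G H : ℝ → ℂ} {x θ r : ℝ}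

theorem norm_modulatedOddPart_le (hpos : ‖G θ‖ ≤ r) (hneg : ‖G (-θ)‖ ≤ r) :
    ‖modulatedOddPart G x θ‖ ≤ r := by
  rw [modulatedOddPart, norm_div, norm_mul, norm_I, Complex.norm_two, mul_one, div_le_iff₀ two_pos]
  refine (norm_sub_le _ _).trans ?_
  rw [norm_mul, norm_mul, norm_exp_ofReal_mul_I, norm_exp_ofReal_mul_I]
  linarith

theorem norm_modulatedOddPart_sub_le (hpos : ‖G θ - H θ‖ ≤ r) (hneg : ‖G (-θ) - H (-θ)‖ ≤ r) :
    ‖modulatedOddPart G x θ - modulatedOddPart H x θ‖ ≤ r := by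
  have hsub : modulatedOddPart G x θ - modulatedOddPart H x θ = modulatedOddPart (G - H) x θ := by
    simp only [modulatedOddPart, Pi.sub_apply]; ring
  exact hsub ▸ norm_modulatedOddPart_le hpos hneg

theorem modulatedOddPart_exp_mul_I {p : ℝ → ℝ} (hp : p.Odd) :
    modulatedOddPart (fun θ => exp (p θ * I)) x θ = Real.sin (x * θ - p θ) := by
  simp only [modulatedOddPart, hp θ, ← exp_add, ← add_mul, ← ofReal_add]
  rw [ofReal_sin, sin, mul_comm 2 I, ← div_div, div_I]
  push_cast
  ring_nf

theorem norm_modulatedOddPart_div_sin_half_le (h0 : 0 < θ) (hπ : θ ≤ Real.pi)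
    (hpos : ‖G θ‖ ≤ r) (hneg : ‖G (-θ)‖ ≤ r) :
    ‖modulatedOddPart G x θ / Real.sin (θ / 2)‖ ≤ r * (Real.pi / θ) := by
  rw [norm_div, norm_real, Real.norm_of_nonneg (sin_half_pos h0 hπ).le, div_eq_mul_inv]
  have hr : 0 ≤ r := (norm_nonneg _).trans hpos
  exact mul_le_mul (norm_modulatedOddPart_le hpos hneg) (inv_sin_half_le h0 hπ)
    (inv_nonneg.2 (sin_half_pos h0 hπ).le) hr

end ModulatedOddPart

section FrequencyRegimes

variable {G : ℝ → ℂ} {x A δ : ℝ}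

theorem norm_modulatedOddPart_div_sin_half_sub_le {x θ β γ B : ℝ} (h0 : 0 < θ) (h1 : θ ≤ 1)
    (hpos : ‖G θ - exp ((β * θ - γ * θ ^ 3 : ℝ) * I)‖ ≤ B * θ)
    (hneg : ‖G (-θ) - exp ((β * -θ - γ * (-θ) ^ 3 : ℝ) * I)‖ ≤ B * θ) :
    ‖modulatedOddPart G x θ / Real.sin (θ / 2)
      - (2 * (Real.sin ((x - β) * θ + γ * θ ^ 3) / θ) : ℝ)‖ ≤ B * Real.pi + 1 := by
  have hπ : θ ≤ Real.pi := by linarith [Real.pi_gt_three]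
  have hodd : (fun θ : ℝ => β * θ - γ * θ ^ 3).Odd := fun θ => by ring
  have hsin : ‖modulatedOddPart G x θ - Real.sin ((x - β) * θ + γ * θ ^ 3)‖ ≤ B * θ := by
    have := norm_modulatedOddPart_sub_le (x := x)
      (H := fun θ => exp ((β * θ - γ * θ ^ 3 : ℝ) * I)) hpos hneg
    rw [modulatedOddPart_exp_mul_I hodd] at this
    convert this using 5
    ring
  set s := Real.sin ((x - β) * θ + γ * θ ^ 3)
  have hsplit : modulatedOddPart G x θ / Real.sin (θ / 2) - (2 * (s / θ) : ℝ)
      = (modulatedOddPart G x θ - s) * ((Real.sin (θ / 2))⁻¹ : ℝ)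
        + (s * ((Real.sin (θ / 2))⁻¹ - 2 / θ) : ℝ) := by push_cast; ring
  rw [hsplit]
  refine (norm_add_le _ _).trans (add_le_add ?_ ?_)
  · rw [norm_mul, norm_real, norm_inv, Real.norm_of_nonneg (sin_half_pos h0 hπ).le]
    calc _ ≤ B * θ * (Real.pi / θ) :=
          mul_le_mul hsin (inv_sin_half_le h0 hπ) (inv_nonneg.2 (sin_half_pos h0 hπ).le)
            ((norm_nonneg _).trans hsin)
      _ = B * Real.pi := by field_simp
  · rw [norm_real, Real.norm_eq_abs, abs_mul]
    exact mul_le_one₀ (Real.abs_sin_le_one _) (abs_nonneg _) (abs_inv_sin_half_sub_le h0 h1)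

theorem norm_integral_modulatedOddPart_low_le {β γ B : ℝ} (hA : 0 ≤ A) (hA1 : A ≤ 1)
    (hG : ∀ θ, |θ| ≤ A → ‖G θ - exp ((β * θ - γ * θ ^ 3 : ℝ) * I)‖ ≤ B * |θ|)
    (hint : IntervalIntegrable (fun θ => modulatedOddPart G x θ / Real.sin (θ / 2)) volume 0 A) :
    ‖∫ θ in (0 : ℝ)..A, modulatedOddPart G x θ / Real.sin (θ / 2)‖
      ≤ 36 + (B * Real.pi + 1) * A := by
  set s : ℝ → ℝ := fun θ => 2 * (Real.sin ((x - β) * θ + γ * θ ^ 3) / θ)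
  have hs_int : IntervalIntegrable (fun θ => (s θ : ℂ)) volume 0 A := by
    have := (intervalIntegrable_sin_linear_add_cubic_div_self (x - β) γ 0 A).const_mul 2
    exact ⟨this.1.ofReal, this.2.ofReal⟩
  have hs_le : ‖∫ θ in (0 : ℝ)..A, (s θ : ℂ)‖ ≤ 36 := by
    rw [integral_ofReal, norm_real, Real.norm_eq_abs, intervalIntegral.integral_const_mul, abs_mul,
      abs_two]
    linarith [abs_integral_sin_linear_add_cubic_div_self_le (x - β) γ hA]
  have hrest := norm_integral_le_of_norm_le_const (a := 0) (b := A) (C := B * Real.pi + 1)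
    (f := fun θ => modulatedOddPart G x θ / Real.sin (θ / 2) - s θ) fun θ hθ => by
      rw [uIoc_of_le hA] at hθ
      have habs : |θ| = θ := abs_of_pos hθ.1
      have hpos := hG θ (habs.trans_le hθ.2)
      have hneg := hG (-θ) ((abs_neg θ).trans habs |>.trans_le hθ.2)
      rw [abs_neg, habs] at hneg
      rw [habs] at hpos
      exact norm_modulatedOddPart_div_sin_half_sub_le hθ.1 (hθ.2.trans hA1) hpos hneg
  rw [integral_sub hint hs_int, sub_zero, abs_of_nonneg hA] at hrest
  linarith [norm_sub_norm_le (∫ θ in (0 : ℝ)..A, modulatedOddPart G x θ / Real.sin (θ / 2))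
    (∫ θ in (0 : ℝ)..A, (s θ : ℂ))]

theorem norm_integral_modulatedOddPart_mid_le {D : ℝ} (hA : 0 < A) (hAδ : A ≤ δ)
    (hδ : δ ≤ Real.pi) (hD : 0 ≤ D) (hG : ∀ θ, A ≤ |θ| → |θ| ≤ δ → ‖G θ‖ ≤ D / |θ|) :
    ‖∫ θ in A..δ, modulatedOddPart G x θ / Real.sin (θ / 2)‖ ≤ D * Real.pi / A := by
  refine norm_integral_le_div_of_norm_le_div_sq hA hAδ (mul_nonneg hD Real.pi_pos.le) fun θ hθ => ?_
  have h0 : 0 < θ := hA.trans_le hθ.1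
  have habs : |θ| = θ := abs_of_pos h0
  calc _ ≤ D / |θ| * (Real.pi / θ) :=
        norm_modulatedOddPart_div_sin_half_le h0 (hθ.2.trans hδ)
          (hG θ (by rw [habs]; exact hθ.1) (by rw [habs]; exact hθ.2))
          (abs_neg θ ▸ hG (-θ) (by rw [abs_neg, habs]; exact hθ.1)
            (by rw [abs_neg, habs]; exact hθ.2))
    _ = D * Real.pi / θ ^ 2 := by rw [habs]; field_simp

theorem norm_integral_modulatedOddPart_high_le (hδ : 0 < δ) (hδπ : δ ≤ Real.pi)
    (hG : ∀ θ ∈ Icc (-Real.pi) Real.pi, ‖G θ‖ ≤ 1) :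
    ‖∫ θ in δ..Real.pi, modulatedOddPart G x θ / Real.sin (θ / 2)‖ ≤ Real.pi ^ 2 / δ := by
  refine (intervalIntegral.norm_integral_le_of_norm_le_const (C := Real.pi / δ)
    fun θ hθ => ?_).trans ?_
  · rw [uIoc_of_le hδπ] at hθ
    have h0 : 0 < θ := hδ.trans hθ.1
    calc _ ≤ 1 * (Real.pi / θ) := norm_modulatedOddPart_div_sin_half_le h0 hθ.2
          (hG θ ⟨by linarith, hθ.2⟩) (hG (-θ) ⟨by linarith [hθ.2], by linarith⟩)
      _ ≤ Real.pi / δ := by rw [one_mul]; gcongr; exact hθ.1.le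
  · rw [abs_of_nonneg (sub_nonneg.2 hδπ)]
    calc Real.pi / δ * (Real.pi - δ) ≤ Real.pi / δ * Real.pi := by gcongr; linarith
      _ = Real.pi ^ 2 / δ := by ring

theorem norm_integral_modulatedOddPart_le {β γ B D : ℝ} (hA : 0 < A) (hAδ : A ≤ δ) (hδ : δ ≤ 1)
    (hD : 0 ≤ D)
    (hlow : ∀ θ, |θ| ≤ A → ‖G θ - exp ((β * θ - γ * θ ^ 3 : ℝ) * I)‖ ≤ B * |θ|)
    (hmid : ∀ θ, A ≤ |θ| → |θ| ≤ δ → ‖G θ‖ ≤ D / |θ|)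
    (hhigh : ∀ θ ∈ Icc (-Real.pi) Real.pi, ‖G θ‖ ≤ 1)
    (hint : IntervalIntegrable (fun θ => modulatedOddPart G x θ / Real.sin (θ / 2)) volume
      0 Real.pi) :
    ‖∫ θ in (0 : ℝ)..Real.pi, modulatedOddPart G x θ / Real.sin (θ / 2)‖
      ≤ 36 + (B * Real.pi + 1) * A + D * Real.pi / A + Real.pi ^ 2 / δ := by
  have hδπ : δ ≤ Real.pi := by linarith [Real.pi_gt_three]
  have hsub : ∀ s t, 0 ≤ s → s ≤ t → t ≤ Real.pi → IntervalIntegrable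
      (fun θ => modulatedOddPart G x θ / Real.sin (θ / 2)) volume s t := fun s t hs hst ht =>
    hint.mono_set <| by
      rw [uIcc_of_le hst, uIcc_of_le Real.pi_pos.le]
      exact Icc_subset_Icc hs ht
  have hint₁ := hsub 0 A le_rfl hA.le (hAδ.trans hδπ)
  have hint₂ := hsub A δ hA.le hAδ hδπ
  have hint₃ := hsub δ Real.pi (hA.le.trans hAδ) hδπ le_rfl
  rw [← integral_add_adjacent_intervals (hint₁.trans hint₂) hint₃,
    ← integral_add_adjacent_intervals hint₁ hint₂]
  exact norm_add₃_le.trans <| add_le_add (add_le_add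
    (norm_integral_modulatedOddPart_low_le hA.le (hAδ.trans hδ) hlow hint₁)
    (norm_integral_modulatedOddPart_mid_le hA hAδ hδπ hD hmid))
    (norm_integral_modulatedOddPart_high_le (hA.trans_le hAδ) hδπ hhigh)

end FrequencyRegimes

section Powers

variable {F : ℝ → ℂ} {α γ K c δ : ℝ} {r n : ℕ}

theorem exists_pos_le_natCast_mul_pow_eq (hδ : 0 < δ) (hr : r ≠ 0) (hn : n ≠ 0) :
    ∃ A : ℝ, 0 < A ∧ A ≤ δ ∧ n * A ^ r = δ ^ r := by
  have : (0 : ℝ) < n := Nat.cast_pos.2 hn.bot_lt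
  have hn1 : (n : ℝ)⁻¹ ≤ 1 := inv_le_one_of_one_le₀ (Nat.one_le_cast.2 hn.bot_lt)
  refine ⟨δ * (n : ℝ)⁻¹ ^ (r : ℝ)⁻¹, by positivity, ?_, ?_⟩
  · exact mul_le_of_le_one_right hδ.le (Real.rpow_le_one (by positivity) hn1 (by positivity))
  · rw [mul_pow, Real.rpow_inv_natCast_pow (by positivity) hr]
    field_simp

theorem norm_pow_sub_exp_le {A θ : ℝ} (hr : r ≠ 0) (hA : 0 < A) (hnA : n * A ^ r = δ ^ r)
    (hK : 0 ≤ K) (hθ : |θ| ≤ A) (hF : ‖F θ‖ ≤ 1)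
    (hexp : ‖F θ - exp ((α * θ - γ * θ ^ 3 : ℝ) * I)‖ ≤ K * |θ| ^ r) :
    ‖F θ ^ n - exp ((n * α * θ - n * γ * θ ^ 3 : ℝ) * I)‖ ≤ K * δ ^ r / A * |θ| := by
  obtain ⟨r, rfl⟩ := Nat.exists_eq_succ_of_ne_zero hr
  have hpow : exp ((n * α * θ - n * γ * θ ^ 3 : ℝ) * I)
      = exp ((α * θ - γ * θ ^ 3 : ℝ) * I) ^ n := by
    rw [← exp_nat_mul]; congr 1; push_cast; ring
  calc _ ≤ n * ‖F θ - exp ((α * θ - γ * θ ^ 3 : ℝ) * I)‖ :=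
        hpow ▸ norm_pow_sub_pow_le_of_norm_le_one hF (norm_exp_ofReal_mul_I _).le n
    _ ≤ n * (K * (A ^ r * |θ|)) := by
        gcongr
        exact hexp.trans (by rw [pow_succ]; gcongr)
    _ = K * (n * A ^ (r + 1)) / A * |θ| := by rw [pow_succ]; field_simp
    _ = _ := by rw [hnA]

theorem norm_pow_le_of_norm_le_exp {A θ : ℝ} (hr : r ≠ 0) (hA : 0 < A)
    (hnA : n * A ^ r = δ ^ r) (hδ : 0 < δ) (hc : 0 < c) (hθ : A ≤ |θ|)
    (hdamp : ‖F θ‖ ≤ Real.exp (-(c * |θ| ^ r))) :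
    ‖F θ ^ n‖ ≤ A / (c * δ ^ r) / |θ| := by
  obtain ⟨r, rfl⟩ := Nat.exists_eq_succ_of_ne_zero hr
  have hlower : c * δ ^ (r + 1) / A * |θ| ≤ n * (c * |θ| ^ (r + 1)) := by
    calc c * δ ^ (r + 1) / A * |θ| = n * (c * (A ^ r * |θ|)) := by
          rw [← hnA, Nat.succ_eq_add_one, pow_succ]; field_simp
      _ ≤ n * (c * |θ| ^ (r + 1)) := by rw [pow_succ]; gcongr
  have hθ0 : 0 < |θ| := hA.trans_le hθ
  calc ‖F θ ^ n‖ ≤ Real.exp (-(c * |θ| ^ (r + 1))) ^ n := by rw [norm_pow]; gcongr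
    _ = (Real.exp (n * (c * |θ| ^ (r + 1))))⁻¹ := by
        rw [← Real.exp_nat_mul, ← Real.exp_neg, mul_neg]
    _ ≤ (c * δ ^ (r + 1) / A * |θ|)⁻¹ :=
        inv_anti₀ (by positivity)
          (hlower.trans ((le_add_of_nonneg_right one_pos.le).trans (Real.add_one_le_exp _)))
    _ = A / (c * δ ^ (r + 1)) / |θ| := by field_simp

theorem norm_integral_modulatedOddPart_pow_le {x : ℝ} (hr : r ≠ 0) (hn : n ≠ 0) (hδ : 0 < δ)
    (hδ1 : δ ≤ 1) (hc : 0 < c) (hK : 0 ≤ K) (hF : ∀ θ ∈ Icc (-Real.pi) Real.pi, ‖F θ‖ ≤ 1)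
    (hexp : ∀ θ, |θ| ≤ δ → ‖F θ - exp ((α * θ - γ * θ ^ 3 : ℝ) * I)‖ ≤ K * |θ| ^ r)
    (hdamp : ∀ θ, |θ| ≤ δ → ‖F θ‖ ≤ Real.exp (-(c * |θ| ^ r)))
    (hint : IntervalIntegrable (fun θ => modulatedOddPart (F ^ n) x θ / Real.sin (θ / 2)) volume
      0 Real.pi) :
    ‖∫ θ in (0 : ℝ)..Real.pi, modulatedOddPart (F ^ n) x θ / Real.sin (θ / 2)‖
      ≤ 37 + K * δ ^ r * Real.pi + Real.pi / (c * δ ^ r) + Real.pi ^ 2 / δ := by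
  obtain ⟨A, hA, hAδ, hnA⟩ := exists_pos_le_natCast_mul_pow_eq hδ hr hn
  have hδπ : δ ≤ Real.pi := by linarith [Real.pi_gt_three]
  have hbound := norm_integral_modulatedOddPart_le (x := x) (G := F ^ n) (β := n * α) (γ := n * γ)
    (B := K * δ ^ r / A) (D := A / (c * δ ^ r)) hA hAδ hδ1 (by positivity)
    (fun θ hθ => norm_pow_sub_exp_le hr hA hnA hK hθ
      (hF θ (abs_le.1 (hθ.trans (hAδ.trans hδπ)))) (hexp θ (hθ.trans hAδ)))
    (fun θ hθA hθδ => norm_pow_le_of_norm_le_exp hr hA hnA hδ hc hθA (hdamp θ hθδ))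
    (fun θ hθ => by
      rw [Pi.pow_apply, norm_pow]; exact pow_le_one₀ (norm_nonneg _) (hF θ hθ)) hint
  calc _ ≤ _ := hbound
    _ = 36 + A + K * δ ^ r * Real.pi + Real.pi / (c * δ ^ r) + Real.pi ^ 2 / δ := by
        field_simp; ring
    _ ≤ _ := by linarith

theorem exists_forall_norm_integral_modulatedOddPart_pow_le (hr : r ≠ 0) (hc : 0 < c)
    (hF : ∀ θ ∈ Icc (-Real.pi) Real.pi, ‖F θ‖ ≤ 1)
    (hexp : (fun θ => F θ - exp ((α * θ - γ * θ ^ 3 : ℝ) * I)) =O[𝓝 0] fun θ => θ ^ r)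
    (hdamp : ∀ᶠ θ in 𝓝 0, ‖F θ‖ ≤ Real.exp (-(c * |θ| ^ r))) :
    ∃ C : ℝ, 0 ≤ C ∧ ∀ n ≠ 0, ∀ x,
      IntervalIntegrable (fun θ => modulatedOddPart (F ^ n) x θ / Real.sin (θ / 2)) volume
        0 Real.pi →
      ‖∫ θ in (0 : ℝ)..Real.pi, modulatedOddPart (F ^ n) x θ / Real.sin (θ / 2)‖ ≤ C := by
  obtain ⟨K, hK, hexpK⟩ := hexp.exists_pos
  obtain ⟨ε, hε, hball⟩ := Metric.eventually_nhds_iff.1 (hexpK.bound.and hdamp)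
  have hδ : 0 < min 1 (ε / 2) := by positivity
  have hnear : ∀ θ : ℝ, |θ| ≤ min 1 (ε / 2) → dist θ 0 < ε := fun θ hθ => by
    rw [Real.dist_0_eq_abs]
    linarith [hθ.trans (min_le_right _ _)]
  refine ⟨_, ?_, fun n hn x hint => norm_integral_modulatedOddPart_pow_le (α := α) (γ := γ)
    (K := K) hr hn hδ (min_le_left _ _) hc hK.le hF (fun θ hθ => ?_)
    (fun θ hθ => (hball (hnear θ hθ)).2) hint⟩
  · positivity
  · simpa using (hball (hnear θ hθ)).1

end Powers

section Expansion

variable {F g : ℝ → ℂ} {p : ℝ → ℝ} {c : ℝ} {r : ℕ}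

theorem isBigO_sub_exp_mul_I_of_eventually_eq (hr : r ≠ 0) (hg : ContinuousAt g 0)
    (hF : ∀ᶠ θ in 𝓝 0, F θ = exp (p θ * I + (|θ| ^ r : ℝ) * g θ)) :
    (fun θ => F θ - exp (p θ * I)) =O[𝓝 0] fun θ => θ ^ r := by
  have hw : (fun θ => ((|θ| ^ r : ℝ) : ℂ) * g θ) =O[𝓝 0] fun θ : ℝ => θ ^ r := by
    have hpow : (fun θ : ℝ => ((|θ| ^ r : ℝ) : ℂ)) =O[𝓝 0] fun θ : ℝ => θ ^ r :=
      .of_bound 1 (.of_forall fun θ => by simp)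
    simpa using hpow.mul (hg.isBigO_one ℝ)
  have hw0 : Tendsto (fun θ => ((|θ| ^ r : ℝ) : ℂ) * g θ) (𝓝 0) (𝓝 0) :=
    hw.trans_tendsto (by simpa [hr] using (continuous_pow r).tendsto (0 : ℝ))
  have hexp : (fun θ => exp ((|θ| ^ r : ℝ) * g θ) - 1) =O[𝓝 0] fun θ : ℝ => θ ^ r := by
    have := (hasDerivAt_exp 0).isBigO_sub.comp_tendsto hw0
    simp only [Function.comp_def, exp_zero, sub_zero] at this
    exact this.trans hw
  refine .trans (.of_bound 1 ?_) hexp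
  filter_upwards [hF] with θ hθ
  have hfactor : F θ - exp (p θ * I) = exp (p θ * I) * (exp ((|θ| ^ r : ℝ) * g θ) - 1) := by
    rw [hθ, exp_add]; ring
  rw [hfactor, norm_mul, norm_exp_ofReal_mul_I]

theorem eventually_norm_le_exp_of_eventually_eq (hg : ContinuousAt g 0) (hc : (g 0).re < -c)
    (hF : ∀ᶠ θ in 𝓝 0, F θ = exp (p θ * I + (|θ| ^ r : ℝ) * g θ)) :
    ∀ᶠ θ in 𝓝 0, ‖F θ‖ ≤ Real.exp (-(c * |θ| ^ r)) := by
  have hre : ContinuousAt (fun θ => (g θ).re) 0 := continuous_re.continuousAt.comp hg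
  filter_upwards [hF, hre.eventually_lt_const hc] with θ hθ hgθ
  rw [hθ, norm_exp, add_re, re_ofReal_mul, re_ofReal_mul, I_re, mul_zero, zero_add]
  gcongr
  calc |θ| ^ r * (g θ).re ≤ |θ| ^ r * -c := by gcongr
    _ = -(c * |θ| ^ r) := by ring

end Expansion

end SingularIntegral

section DirichletKernel

open MeasureTheory

theorem sin_natCast_add_half_mul (k : ℕ) (θ : ℝ) :
    Real.sin ((k + 1 / 2) * θ)
      = (1 + ∑ i ∈ Finset.range k, 2 * Real.cos ((i + 1) * θ)) * Real.sin (θ / 2) := by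
  induction k with
  | zero => simp [div_eq_inv_mul]
  | succ k ih =>
    have hadd : ((k + 1 : ℕ) + 1 / 2) * θ = (k + 1) * θ + θ / 2 := by push_cast; ring
    have hsub : (k + 1 / 2) * θ = (k + 1) * θ - θ / 2 := by ring
    rw [Finset.sum_range_succ, ← add_assoc, add_mul _ _ (Real.sin (θ / 2)), ← ih, hadd, hsub,
      Real.sin_add, Real.sin_sub]
    ring

theorem eqOn_sin_natCast_add_half_mul_div_sin_half (k : ℕ) :
    Set.EqOn (fun θ => 1 + ∑ i ∈ Finset.range k, 2 * Real.cos ((i + 1) * θ))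
      (fun θ => Real.sin ((k + 1 / 2) * θ) / Real.sin (θ / 2)) (Set.uIoc 0 Real.pi) := by
  intro θ hθ
  rw [Set.uIoc_of_le Real.pi_pos.le] at hθ
  exact eq_div_of_mul_eq (sin_half_pos hθ.1 hθ.2).ne' (sin_natCast_add_half_mul k θ).symm

theorem intervalIntegrable_sin_natCast_add_half_mul_div_sin_half (k : ℕ) :
    IntervalIntegrable (fun θ => Real.sin ((k + 1 / 2) * θ) / Real.sin (θ / 2)) volume
      0 Real.pi :=
  (Continuous.intervalIntegrable (by fun_prop) _ _).congr
    (eqOn_sin_natCast_add_half_mul_div_sin_half k)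

theorem integral_sin_natCast_add_half_mul_div_sin_half (k : ℕ) :
    ∫ θ in (0 : ℝ)..Real.pi, Real.sin ((k + 1 / 2) * θ) / Real.sin (θ / 2) = Real.pi := by
  have hcos : ∀ i ∈ Finset.range k,
      ∫ θ in (0 : ℝ)..Real.pi, 2 * Real.cos ((i + 1) * θ) = 0 := fun i _ => by
    have hi : (i + 1 : ℝ) ≠ 0 := by positivity
    have hsin : Real.sin ((i + 1) * Real.pi) = 0 := mod_cast Real.sin_nat_mul_pi (i + 1)
    rw [intervalIntegral.integral_const_mul, intervalIntegral.integral_comp_mul_left _ hi,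
      integral_cos, hsin]
    simp
  rw [← intervalIntegral.integral_congr_ae
      (.of_forall (eqOn_sin_natCast_add_half_mul_div_sin_half k)),
    intervalIntegral.integral_add (by simp) (Continuous.intervalIntegrable (by fun_prop) _ _),
    intervalIntegral.integral_finsetSum
      fun i _ => Continuous.intervalIntegrable (by fun_prop) _ _,
    Finset.sum_eq_zero hcos]
  simp

theorem exists_intCast_sub_half_eq_of_pos {k : ℤ} (hk : 0 < k) :
    ∃ l : ℕ, (k - 1 / 2 : ℝ) = l + 1 / 2 := by
  obtain ⟨l, rfl⟩ := Int.eq_succ_of_zero_lt hk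
  exact ⟨l, by push_cast; ring⟩

theorem exists_intCast_sub_half_eq_of_nonpos {k : ℤ} (hk : k ≤ 0) :
    ∃ l : ℕ, (k - 1 / 2 : ℝ) = -(l + 1 / 2) := by
  obtain ⟨l, rfl⟩ := Int.exists_eq_neg_ofNat hk
  exact ⟨l, by push_cast; ring⟩

theorem intervalIntegrable_sin_intCast_sub_half_mul_div_sin_half (k : ℤ) :
    IntervalIntegrable (fun θ => Real.sin ((k - 1 / 2) * θ) / Real.sin (θ / 2)) volume
      0 Real.pi := by
  by_cases hk : 0 < k
  · obtain ⟨l, hl⟩ := exists_intCast_sub_half_eq_of_pos hk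
    exact hl ▸ intervalIntegrable_sin_natCast_add_half_mul_div_sin_half l
  · obtain ⟨l, hl⟩ := exists_intCast_sub_half_eq_of_nonpos (not_lt.1 hk)
    simp only [hl, neg_mul, Real.sin_neg, neg_div]
    exact (intervalIntegrable_sin_natCast_add_half_mul_div_sin_half l).neg

theorem integral_sin_intCast_sub_half_mul_div_sin_half (k : ℤ) :
    ∫ θ in (0 : ℝ)..Real.pi, Real.sin ((k - 1 / 2) * θ) / Real.sin (θ / 2)
      = if 0 < k then Real.pi else -Real.pi := by
  split_ifs with hk
  · obtain ⟨l, hl⟩ := exists_intCast_sub_half_eq_of_pos hk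
    exact hl ▸ integral_sin_natCast_add_half_mul_div_sin_half l
  · obtain ⟨l, hl⟩ := exists_intCast_sub_half_eq_of_nonpos (not_lt.1 hk)
    simp only [hl, neg_mul, Real.sin_neg, neg_div, intervalIntegral.integral_neg,
      integral_sin_natCast_add_half_mul_div_sin_half]

end DirichletKernel

namespace LaurentBV

section GroupAlgebra

/-- The action of `ℤ` on sequences by shifts; its extension to the group algebra is convolution. -/
def translation : Multiplicative ℤ →* Module.End ℂ (ℤ → ℂ) where
  toFun k := LinearMap.funLeft ℂ ℂ fun j => j - k.toAdd
  map_one' := by ext; simp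
  map_mul' k l := by ext; simp [sub_sub]

/-- The character `ℓ ↦ e^{iℓθ}` of `ℤ`; its extension to the group algebra is evaluation of the
Fourier symbol at `θ`. -/
noncomputable def character (θ : ℂ) : Multiplicative ℤ →* ℂ where
  toFun k := Complex.exp (Complex.I * (k.toAdd : ℂ) * θ)
  map_one' := by simp
  map_mul' k l := by simp [mul_add, add_mul, Complex.exp_add]

theorem laurentOp_coe (q : ℤ →₀ ℂ) (u : ℤ → ℂ) (j : ℤ) :
    laurentOp q u j = q.sum fun ℓ b => b * u (j - ℓ) :=
  tsum_eq_sum fun ℓ hℓ => by rw [Finsupp.notMem_support_iff.1 hℓ, zero_mul]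

theorem fourierSymbol_coe (q : ℤ →₀ ℂ) (θ : ℂ) :
    fourierSymbol q θ = q.sum fun ℓ b => b * Complex.exp (Complex.I * (ℓ : ℂ) * θ) :=
  tsum_eq_sum fun ℓ hℓ => by rw [Finsupp.notMem_support_iff.1 hℓ, zero_mul]

variable (p : AddMonoidAlgebra ℂ ℤ)

theorem laurentOp_coeff :
    laurentOp p.coeff = AddMonoidAlgebra.lift ℂ (Module.End ℂ (ℤ → ℂ)) ℤ translation p := by
  ext u j
  simp [laurentOp_coe, AddMonoidAlgebra.lift_apply, Finsupp.sum, translation]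

theorem fourierSymbol_coeff (θ : ℂ) :
    fourierSymbol p.coeff θ = AddMonoidAlgebra.lift ℂ ℂ ℤ (character θ) p :=
  fourierSymbol_coe p.coeff θ

theorem iterate_laurentOp_coeff (n : ℕ) :
    (laurentOp p.coeff)^[n] = laurentOp (p ^ n).coeff := by
  rw [laurentOp_coeff, laurentOp_coeff, map_pow, Module.End.coe_pow]

theorem fourierSymbol_coeff_pow (n : ℕ) (θ : ℂ) :
    fourierSymbol (p ^ n).coeff θ = fourierSymbol p.coeff θ ^ n := by
  rw [fourierSymbol_coeff, fourierSymbol_coeff, map_pow]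

theorem exists_coeff_eq {a : ℤ → ℂ} (ha : (Function.support a).Finite) :
    ∃ p : AddMonoidAlgebra ℂ ℤ, ⇑p.coeff = a :=
  ⟨.ofCoeff (.ofSupportFinite a ha), rfl⟩

end GroupAlgebra

section Step

open MeasureTheory

/-- The Heaviside sequence, with value `0` at `0`. -/
def unitStep (k : ℤ) : ℂ := if 0 < k then 1 else 0

theorem norm_unitStep_le (k : ℤ) : ‖unitStep k‖ ≤ 1 := by
  unfold unitStep; split_ifs <;> simp

theorem intervalIntegrable_unitStep_kernel (k : ℤ) : IntervalIntegrable
    (fun θ : ℝ => ((Real.sin ((k - 1 / 2) * θ) / Real.sin (θ / 2) : ℝ) : ℂ)) volume 0 Real.pi :=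
  have h := intervalIntegrable_sin_intCast_sub_half_mul_div_sin_half k
  ⟨h.1.ofReal, h.2.ofReal⟩

theorem unitStep_eq_integral (k : ℤ) :
    unitStep k = 1 / 2 + (∫ θ in (0 : ℝ)..Real.pi,
      ((Real.sin ((k - 1 / 2) * θ) / Real.sin (θ / 2) : ℝ) : ℂ)) / (2 * Real.pi) := by
  have hπ : (Real.pi : ℂ) ≠ 0 := Complex.ofReal_ne_zero.2 Real.pi_ne_zero
  rw [unitStep, intervalIntegral.integral_ofReal, integral_sin_intCast_sub_half_mul_div_sin_half]
  split_ifs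
  · field_simp; norm_num
  · push_cast; field_simp; norm_num

variable (q : ℤ →₀ ℂ) (m : ℤ)

theorem modulatedOddPart_fourierSymbol (x θ : ℝ) :
    modulatedOddPart (fun θ => fourierSymbol q θ) x θ
      = q.sum fun ℓ b => b * Real.sin ((x - ℓ) * θ) := by
  simp only [modulatedOddPart, fourierSymbol_coe, Finsupp.sum, Finset.mul_sum,
    ← Finset.sum_sub_distrib, Finset.sum_div]
  refine Finset.sum_congr rfl fun ℓ _ => ?_
  have hodd : (fun θ : ℝ => ℓ * θ).Odd := fun θ => mul_neg _ _
  rw [sub_mul, ← modulatedOddPart_exp_mul_I hodd, modulatedOddPart]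
  push_cast
  ring_nf

theorem modulatedOddPart_fourierSymbol_div_sin_half (θ : ℝ) :
    modulatedOddPart (fun θ => fourierSymbol q θ) (m - 1 / 2) θ / Real.sin (θ / 2)
      = ∑ ℓ ∈ q.support, q ℓ *
        ((Real.sin (((m - ℓ : ℤ) - 1 / 2) * θ) / Real.sin (θ / 2) : ℝ) : ℂ) := by
  rw [modulatedOddPart_fourierSymbol, Finsupp.sum, Finset.sum_div]
  refine Finset.sum_congr rfl fun ℓ _ => ?_
  push_cast
  rw [mul_div_assoc, sub_right_comm]

theorem intervalIntegrable_modulatedOddPart_fourierSymbol : IntervalIntegrable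
    (fun θ => modulatedOddPart (fun θ => fourierSymbol q θ) (m - 1 / 2) θ / Real.sin (θ / 2))
    volume 0 Real.pi := by
  simp only [modulatedOddPart_fourierSymbol_div_sin_half]
  simpa only [Finset.sum_fn] using IntervalIntegrable.sum q.support fun ℓ _ =>
    (intervalIntegrable_unitStep_kernel (m - ℓ)).const_mul (q ℓ)

theorem laurentOp_unitStep_eq_integral :
    laurentOp q unitStep m = fourierSymbol q 0 / 2 + (∫ θ in (0 : ℝ)..Real.pi,
      modulatedOddPart (fun θ => fourierSymbol q θ) (m - 1 / 2) θ / Real.sin (θ / 2))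
        / (2 * Real.pi) := by
  have hint := fun ℓ (_ : ℓ ∈ q.support) =>
    (intervalIntegrable_unitStep_kernel (m - ℓ)).const_mul (q ℓ)
  simp only [modulatedOddPart_fourierSymbol_div_sin_half]
  rw [intervalIntegral.integral_finsetSum hint, laurentOp_coe, fourierSymbol_coe, Finsupp.sum,
    Finsupp.sum, Finset.sum_div, Finset.sum_div, ← Finset.sum_add_distrib]
  refine Finset.sum_congr rfl fun ℓ _ => ?_
  rw [unitStep_eq_integral, intervalIntegral.integral_const_mul, mul_zero, Complex.exp_zero]
  ring

theorem norm_laurentOp_unitStep_le {C : ℝ} (h0 : ‖fourierSymbol q 0‖ ≤ 1)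
    (hC : ‖∫ θ in (0 : ℝ)..Real.pi, modulatedOddPart (fun θ => fourierSymbol q θ) (m - 1 / 2) θ
      / Real.sin (θ / 2)‖ ≤ C) :
    ‖laurentOp q unitStep m‖ ≤ 1 + C := by
  rw [laurentOp_unitStep_eq_integral]
  refine (norm_add_le _ _).trans (add_le_add ?_ ?_)
  · rw [norm_div, Complex.norm_two]
    linarith
  · rw [norm_div, norm_mul, Complex.norm_two, Complex.norm_real,
      Real.norm_of_nonneg Real.pi_pos.le]
    exact (div_le_self (norm_nonneg _) (by linarith [Real.pi_gt_three])).trans hC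

theorem exists_forall_norm_iterate_laurentOp_unitStep_le {a : ℤ → ℂ}
    (ha : (Function.support a).Finite)
    (hF : ∀ θ ∈ Set.Icc (-Real.pi) Real.pi, ‖fourierSymbol a (θ : ℝ)‖ ≤ 1) {α c₃ c : ℝ} {r : ℕ}
    (hr : r ≠ 0) (hc : 0 < c)
    (hexp : (fun θ : ℝ => fourierSymbol a θ - Complex.exp ((α * θ - c₃ * θ ^ 3 : ℝ) * Complex.I))
      =O[𝓝 0] fun θ : ℝ => θ ^ r)
    (hdamp : ∀ᶠ θ : ℝ in 𝓝 0, ‖fourierSymbol a θ‖ ≤ Real.exp (-(c * |θ| ^ r))) :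
    ∃ C : ℝ, ∀ n m, ‖(laurentOp a)^[n] unitStep m‖ ≤ C := by
  obtain ⟨p, rfl⟩ := exists_coeff_eq ha
  obtain ⟨C, hC0, hC⟩ := exists_forall_norm_integral_modulatedOddPart_pow_le hr hc hF hexp hdamp
  refine ⟨1 + C, fun n m => ?_⟩
  rcases eq_or_ne n 0 with rfl | hn
  · exact (norm_unitStep_le m).trans (le_add_of_nonneg_right hC0)
  have hpow : (fun θ : ℝ => fourierSymbol (p ^ n).coeff θ)
      = (fun θ : ℝ => fourierSymbol p.coeff θ) ^ n :=
    funext fun θ => fourierSymbol_coeff_pow p n θ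
  have hint := intervalIntegrable_modulatedOddPart_fourierSymbol (p ^ n).coeff m
  rw [iterate_laurentOp_coeff]
  refine norm_laurentOp_unitStep_le _ m ?_ ?_
  · rw [fourierSymbol_coeff_pow, norm_pow]
    exact pow_le_one₀ (norm_nonneg _)
      (by simpa using hF 0 ⟨neg_nonpos.2 Real.pi_pos.le, Real.pi_pos.le⟩)
  · rw [hpow] at hint ⊢
    exact hC n hn _ hint

end Step

section BoundedVariation

variable {u : ℤ → ℂ}

theorem BV.summable (hu : BV u) : Summable fun k => u (k + 1) - u k :=
  .of_nnnorm (ENNReal.tsum_coe_ne_top_iff_summable.1 hu.ne)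

theorem hasSum_jump_natCast (hu : Summable fun k => u (k + 1) - u k)
    (h0 : Filter.Tendsto u Filter.atBot (𝓝 0)) (m : ℤ) :
    HasSum (fun i : ℕ => u (m - 1 - i + 1) - u (m - 1 - i)) (u m) := by
  have hinj : Function.Injective fun i : ℕ => m - 1 - (i : ℤ) :=
    sub_right_injective.comp Nat.cast_injective
  have hpartial : ∀ N : ℕ, ∑ i ∈ Finset.range N, (u (m - 1 - i + 1) - u (m - 1 - i))
      = u m - u (m - N) := fun N => by
    have := Finset.sum_range_sub' (fun i : ℕ => u (m - i)) N
    simp only [Nat.cast_zero, sub_zero, Nat.cast_succ] at this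
    rw [← this]
    exact Finset.sum_congr rfl fun i _ => by congr 2 <;> ring
  have htail : Filter.Tendsto (fun N : ℕ => m - (N : ℤ)) Filter.atTop Filter.atBot :=
    Filter.tendsto_atBot_add_const_left _ m
      (Filter.tendsto_neg_atTop_atBot.comp tendsto_natCast_atTop_atTop)
  refine (hu.comp_injective hinj).hasSum_iff_tendsto_nat.2 ?_
  simpa [hpartial] using (h0.comp htail).const_sub (u m)

theorem hasSum_jump_mul_unitStep (hu : Summable fun k => u (k + 1) - u k)
    (h0 : Filter.Tendsto u Filter.atBot (𝓝 0)) (m : ℤ) :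
    HasSum (fun k => (u (k + 1) - u k) * unitStep (m - k)) (u m) := by
  have hinj : Function.Injective fun i : ℕ => m - 1 - (i : ℤ) :=
    sub_right_injective.comp Nat.cast_injective
  rw [← hinj.hasSum_iff fun k hk => ?_]
  · refine (hasSum_jump_natCast hu h0 m).congr_fun fun i => ?_
    rw [Function.comp_apply, unitStep, if_pos (by omega), mul_one]
  · have hmk : ¬0 < m - k := fun hpos => hk ⟨(m - 1 - k).toNat, by simp only; omega⟩
    rw [unitStep, if_neg hmk, mul_zero]

theorem hasSum_jump_mul_laurentOp_unitStep (hu : Summable fun k => u (k + 1) - u k)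
    (h0 : Filter.Tendsto u Filter.atBot (𝓝 0)) (q : ℤ →₀ ℂ) (m : ℤ) :
    HasSum (fun k => (u (k + 1) - u k) * laurentOp q unitStep (m - k)) (laurentOp q u m) := by
  simp only [laurentOp_coe, Finsupp.sum, Finset.mul_sum]
  refine hasSum_sum fun ℓ _ => ?_
  simpa only [mul_left_comm, sub_right_comm] using
    (hasSum_jump_mul_unitStep hu h0 (m - ℓ)).mul_left (q ℓ)

theorem supNorm_laurentOp_le {q : ℤ →₀ ℂ} {C : ℝ≥0} (hC : ∀ m, ‖laurentOp q unitStep m‖ ≤ C)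
    (hu : BV u) (h0 : Filter.Tendsto u Filter.atBot (𝓝 0)) :
    supNorm (laurentOp q u) ≤ C * totalVariation u := by
  refine iSup_le fun m => ?_
  rw [← (hasSum_jump_mul_laurentOp_unitStep hu.summable h0 q m).tsum_eq, totalVariation,
    ← ENNReal.tsum_mul_left]
  refine enorm_tsum_le_tsum_enorm.trans (ENNReal.tsum_le_tsum fun k => ?_)
  rw [enorm_mul, mul_comm]
  gcongr
  exact enorm_le_coe.2 (hC (m - k))

end BoundedVariation

namespace DispersiveAssumption

variable {a : ℤ → ℂ}

theorem norm_fourierSymbol_le_one (ha : DispersiveAssumption a) {θ : ℝ}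
    (hθ : θ ∈ Set.Icc (-Real.pi) Real.pi) : ‖fourierSymbol a θ‖ ≤ 1 := by
  rcases eq_or_ne θ 0 with rfl | h0
  · simp [fourierSymbol, ha.sum_eq_one]
  · exact (ha.dissipation θ ⟨hθ, h0⟩).le

theorem exists_eventually_fourierSymbol_eq (ha : DispersiveAssumption a) :
    ∃ α c₃ c : ℝ, 0 < c ∧ ∃ g : ℝ → ℂ, ContinuousAt g 0 ∧ (g 0).re < -c ∧
      ∀ᶠ θ : ℝ in 𝓝 0, fourierSymbol a θ = Complex.exp
        ((α * θ - c₃ * θ ^ 3 : ℝ) * Complex.I + (|θ| ^ 4 : ℝ) * g θ) := by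
  obtain ⟨α, c₃, c₄, -, hc₄, φ, hφ, hexp⟩ := ha.expansion
  have hreal : Filter.Tendsto (fun θ : ℝ => (θ : ℂ)) (𝓝 0) (𝓝 0) :=
    Complex.continuous_ofReal.tendsto' 0 0 Complex.ofReal_zero
  have : ContinuousAt (fun θ : ℝ => φ θ) 0 :=
    ContinuousAt.comp (by simpa using hφ.continuousAt) Complex.continuous_ofReal.continuousAt
  refine ⟨α, c₃, c₄ / 2, half_pos hc₄, fun θ => -c₄ + θ * φ θ, by fun_prop, by simp; linarith, ?_⟩
  filter_upwards [hreal.eventually hexp] with θ hθ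
  rw [hθ, Even.pow_abs (by decide)]
  push_cast
  ring_nf

theorem exists_isBigO_and_eventually_norm_le (ha : DispersiveAssumption a) :
    ∃ α c₃ c : ℝ, 0 < c ∧
      ((fun θ : ℝ => fourierSymbol a θ - Complex.exp ((α * θ - c₃ * θ ^ 3 : ℝ) * Complex.I))
        =O[𝓝 0] fun θ : ℝ => θ ^ 4) ∧
      ∀ᶠ θ : ℝ in 𝓝 0, ‖fourierSymbol a θ‖ ≤ Real.exp (-(c * |θ| ^ 4)) := by
  obtain ⟨α, c₃, c, hc, g, hg, hgc, hF⟩ := ha.exists_eventually_fourierSymbol_eq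
  exact ⟨α, c₃, c, hc, isBigO_sub_exp_mul_I_of_eventually_eq four_ne_zero hg hF,
    eventually_norm_le_exp_of_eventually_eq hg hgc hF⟩

end DispersiveAssumption

end LaurentBV

open LaurentBV in
theorem corollary3_general (a : ℤ → ℂ) (ha : (Function.support a).Finite)
    (hF : ∀ θ ∈ Set.Icc (-Real.pi) Real.pi, ‖fourierSymbol a (θ : ℝ)‖ ≤ 1) {α c₃ c : ℝ} {r : ℕ}
    (hr : r ≠ 0) (hc : 0 < c)
    (hexp : (fun θ : ℝ => fourierSymbol a θ - Complex.exp ((α * θ - c₃ * θ ^ 3 : ℝ) * Complex.I))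
      =O[𝓝 0] fun θ : ℝ => θ ^ r)
    (hdamp : ∀ᶠ θ : ℝ in 𝓝 0, ‖fourierSymbol a θ‖ ≤ Real.exp (-(c * |θ| ^ r))) :
    ∃ C : ℝ≥0, 0 < C ∧ ∀ u : ℤ → ℂ, BV u → Filter.Tendsto u Filter.atBot (𝓝 0) →
      (⨆ n : ℕ, supNorm ((laurentOp a)^[n] u)) ≤ (C : ℝ≥0∞) * totalVariation u := by
  obtain ⟨C, hC⟩ := exists_forall_norm_iterate_laurentOp_unitStep_le ha hF hr hc hexp hdamp
  obtain ⟨p, rfl⟩ := exists_coeff_eq ha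
  refine ⟨C.toNNReal + 1, by positivity, fun u hu h0 => iSup_le fun n => ?_⟩
  rw [iterate_laurentOp_coeff]
  refine supNorm_laurentOp_le (fun m => ?_) hu h0
  rw [← iterate_laurentOp_coeff]
  push_cast
  linarith [hC n m, Real.le_coe_toNNReal C]

theorem corollary3 (a : ℤ → ℂ) (ha : LaurentBV.DispersiveAssumption a) :
    ∃ C : ℝ≥0, 0 < C ∧
      ∀ u : ℤ → ℂ, LaurentBV.BV u → Filter.Tendsto u Filter.atBot (𝓝 0) →
        (⨆ n : ℕ, LaurentBV.supNorm ((LaurentBV.laurentOp a)^[n] u))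
          ≤ (C : ℝ≥0∞) * LaurentBV.totalVariation u := by
  obtain ⟨α, c₃, c, hc, hexp, hdamp⟩ := ha.exists_isBigO_and_eventually_norm_le
  exact corollary3_general a ha.finite_support (fun _ => ha.norm_fourierSymbol_le_one) four_ne_zero
    hc hexp hdamp
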